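/- Let $n\ge 3$ and $k\ge 0$ be integers and let $X,Y>0$ be real numbers. Let $\mathcal G=(\mathcal V,\mathcal E)$ be a finite undirected graph and $\mathcal P$ a path in $\mathcal G$ with $|\mathcal P|=n$ vertices, from $S$ to $T$, that is a shortest $S$–$T$ path, i.e. $d(S,T)=|\mathcal P|-1$. In the dynamic Defender–Attacker Blotto game on $(\mathcal G,\mathcal P)$ the defender and the adversary hold asset distributions $x(t),y(t)\in\mathbb R_{\ge 0}^{\mathcal V}$ with $\sum_v x_v(t)=X$ and $\sum_v y_v(t)=Y$. A state is safe if $x_v\ge y_v$ for all $v\in\mathcal P$. The adversary chooses $y(0)$; the defender observes it and chooses $x(0)$ so that the initial state is safe. At each time $t=0,1,2,\dots$ the defender moves first, $x(t+1)=K^D(t)\,x(t)$, and then the adversary moves, $y(t+1)=K^A(t)\,y(t)$, where $K^D(t)$ and $K^A(t)$ are column-stochastic matrices with nonnegative entries whose $(i,j)$ entry is positive only if $i=j$ or $\{i,j\}\in\mathcal E$ (assets stay put or move along one edge). The defender uses a fixed policy $K^D(t)=\pi^D(x(t),\widehat y(t))$, where $\widehat y(t)$ is the restriction of $y(t)$ to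 the set of vertices at distance at most $k$ from $\mathcal P$; the matrices $K^A(t)$ are arbitrary. We say that $\mathcal P$ can be defended in $\mathcal G$ (with $X$ against $Y$ assets and sensing distance $k$) if there is a policy $\pi^D$ such that for every $y(0)$ there is a safe choice of $x(0)$ from which, for all adversary moves, the state is safe for all $t$. Then the condition $$X\ \ge\ \Big(3\Big\lfloor \frac{n}{2k+3}\Big\rfloor+\min\{\,n \bmod (2k+3),\,3\,\}\Big)\,Y$$ is sufficient for $\mathcal P$ to be defended in any such graph $\mathcal G$, and it is necessary for $\mathcal P$ to be defended across all graph structures. That is, the condition holds if and only if for every finite graph $\mathcal G$ and every shortest path $\mathcal P$ in $\mathcal G$ with $n$ vertices, $\mathcal P$ can be defended in $\mathcal G$. -/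

import Mathlib

universe u

namespace PathDefense

/-- An asset distribution of total mass `M`: nonnegative amounts on the vertices, summing
to `M`. -/
def IsAllocation {V : Type u} [Fintype V] (M : ℝ) (z : V → ℝ) : Prop :=
  (∀ v, 0 ≤ z v) ∧ ∑ v, z v = M

/-- A transition matrix that respects the graph: nonnegative entries, columns summing to one,
and assets only stay where they are or move along an edge. The entry `K i j` is the fraction of
the assets at `j` that is sent to `i`. -/
def IsTransition {V : Type u} [Fintype V] (G : SimpleGraph V) (K : Matrix V V ℝ) : Prop :=
  (∀ i j, 0 ≤ K i j) ∧ (∀ j, ∑ i, K i j = 1) ∧ ∀ i j, 0 < K i j → i = j ∨ G.Adj i j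

/-- `P` is a shortest path between its end points. -/
def IsShortestPath {V : Type u} (G : SimpleGraph V) {S T : V} (P : G.Walk S T) : Prop :=
  P.IsPath ∧ G.dist S T = P.length

/-- The distance from a vertex to the path (`⊤` if no path vertex is reachable). -/
noncomputable def pathDist {V : Type u} (G : SimpleGraph V) {S T : V} (P : G.Walk S T)
    (v : V) : ℕ∞ :=
  ⨅ p ∈ P.support, G.edist v p

/-- The vertices within `k` hops of the path. -/
def visibleRegion {V : Type u} (G : SimpleGraph V) {S T : V} (P : G.Walk S T) (k : ℕ) : Set V :=
  {v | pathDist G P v ≤ k}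

/-- Every path vertex holds at least as many defender assets as adversary assets. -/
def IsSafe {V : Type u} (G : SimpleGraph V) {S T : V} (P : G.Walk S T) (x y : V → ℝ) : Prop :=
  ∀ v ∈ P.support, y v ≤ x v

/-- A defender control policy: from the defender distribution and the adversary distribution
restricted to the visible region it computes the matrix of the next defender move. -/
abbrev Policy {V : Type u} (G : SimpleGraph V) {S T : V} (P : G.Walk S T) (k : ℕ) : Type u :=
  (V → ℝ) → (visibleRegion G P k → ℝ) → Matrix V V ℝ

/-- The pair of distributions (defender, adversary) at each time, when the defender follows the
policy `π` and the adversary uses the transition matrices `KA`. -/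
def play {V : Type u} [Fintype V] {G : SimpleGraph V} {S T : V} {P : G.Walk S T} {k : ℕ}
    (π : Policy G P k) (KA : ℕ → Matrix V V ℝ) (x₀ y₀ : V → ℝ) : ℕ → (V → ℝ) × (V → ℝ)
  | 0 => (x₀, y₀)
  | t + 1 =>
    ((π (play π KA x₀ y₀ t).1 (fun v => (play π KA x₀ y₀ t).2 v.1)).mulVec (play π KA x₀ y₀ t).1,
      (KA t).mulVec (play π KA x₀ y₀ t).2)

/-- With `X` assets and sensing distance `k` the defender can guarantee the defense of `P`
for all time against an adversary with `Y` assets: some admissible policy has, for every initial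
adversary distribution, a safe initial defender distribution from which the play stays safe
whatever admissible moves the adversary makes. -/
def CanDefend {V : Type u} [Fintype V] (G : SimpleGraph V) {S T : V} (P : G.Walk S T) (k : ℕ)
    (X Y : ℝ) : Prop :=
  ∃ π : Policy G P k, (∀ x y, IsTransition G (π x y)) ∧
    ∀ y₀ : V → ℝ, IsAllocation Y y₀ →
      ∃ x₀ : V → ℝ, IsAllocation X x₀ ∧ IsSafe G P x₀ y₀ ∧
        ∀ KA : ℕ → Matrix V V ℝ, (∀ t, IsTransition G (KA t)) →
          ∀ t, IsSafe G P (play π KA x₀ y₀ t).1 (play π KA x₀ y₀ t).2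

end PathDefense

/-!
# Defending a shortest path with limited sensing

The constant is the number of *tokens* that suffice against a single unsplit adversary, each token
standing for `Y` defender assets.

**Sufficiency.** The dynamics are linear, so it is enough to say where each token is when the whole
adversary sits at `u`: the defender mirrors every bit of adversary assets at `u` onto the token
positions for `u` (`tokenResponse`). If every token moves by at most one step when the adversary
does, the mirrored distribution can follow any adversary move by splitting the flow along the tokens
(`exists_isTransition_tokenResponse`). If the tokens for `u` occupy all path vertices within one
step of `u`, the next adversary move cannot break safety (`le_tokenResponse`). If the tokens do not
distinguish between invisible vertices, the response is a function of the visible data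
(`tokenResponse_congr`). These facts make up `canDefend_of_tokens`. The tokens
themselves are grouped in triples of consecutive path vertices, one triple per block of `2 * k + 3`
path vertices. A triple rests in the middle of its block and follows the projection
`u ↦ dist S u` of the adversary to the path, but may leave its rest position by at most the number
of steps (at most `k`) by which the adversary has come into sight (`tokenIndex`, `slack`). Clamping
a Lipschitz function by Lipschitz bounds is Lipschitz, so triples move one step at a time, and when
the adversary is adjacent to the path the slack is `k`, which lets the triple reach both ends of
its block.

**Necessity.** On a strip with king's moves, whose bottom row is the path, the adversary walks along
the top row, which is out of sight, to the middle column of the first three vertices of some block,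
and then descends. It is seen only `k` moves before it threatens these three vertices, so the
assets that guard them were at most `k` columns away from them while the defender was blind.
For different blocks these windows of `2 * k + 3` columns are disjoint, and the blind defender's
distribution does not depend on the block attacked, so it holds `Y` for every target at once
(`tokenCount_mul_le_of_canDefend`).
-/

namespace PathDefense

/-! ### Transition matrices -/

section Transition

variable {V : Type u} [Fintype V] {G : SimpleGraph V}

/-- A transition matrix can realize every mass flow along stays and edges: if `F i j` is the
amount to be sent from `j` to `i`, dividing column `j` by the mass present at `j` gives the
matrix. -/
theorem exists_isTransition_of_flow (F : V → V → ℝ) (hF : ∀ i j, 0 ≤ F i j)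
    (hadj : ∀ i j, 0 < F i j → i = j ∨ G.Adj i j) :
    ∃ K : Matrix V V ℝ, IsTransition G K ∧
      K.mulVec (fun j => ∑ i, F i j) = fun i => ∑ j, F i j := by
  classical
  -- Columns that carry no mass are irrelevant for the flow; there the assets stay put.
  refine ⟨fun i j => if ∑ i, F i j = 0 then (if i = j then 1 else 0)
    else F i j / ∑ i, F i j, ⟨fun i j => ?_, fun j => ?_, fun i j => ?_⟩, ?_⟩
  · dsimp only
    split_ifs
    · exact zero_le_one
    · exact le_rfl
    · exact div_nonneg (hF i j) (Finset.sum_nonneg fun i _ => hF i j)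
  · by_cases h : ∑ i, F i j = 0
    · simp [h]
    · simp only [h, if_false]
      rw [← Finset.sum_div, div_self h]
  · intro hpos
    dsimp only at hpos
    split_ifs at hpos with h1 h2
    · exact Or.inl h2
    · exact absurd hpos (lt_irrefl _)
    · refine hadj i j ((hF i j).lt_of_ne fun h0 => ?_)
      rw [← h0, zero_div] at hpos
      exact lt_irrefl _ hpos
  · funext i
    simp only [Matrix.mulVec, dotProduct]
    refine Finset.sum_congr rfl fun j _ => ?_
    split_ifs with h1 h2
    · rw [h1, mul_zero]
      exact ((Finset.sum_eq_zero_iff_of_nonneg fun i _ => hF i j).1 h1 i (Finset.mem_univ i)).symm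
    · rw [h1, mul_zero]
      exact ((Finset.sum_eq_zero_iff_of_nonneg fun i _ => hF i j).1 h1 i (Finset.mem_univ i)).symm
    · exact div_mul_cancel₀ _ h1

theorem isTransition_one [DecidableEq V] : IsTransition G (1 : Matrix V V ℝ) := by
  refine ⟨fun i j => ?_, fun j => ?_, fun i j h => ?_⟩
  · rw [Matrix.one_apply]; split_ifs <;> norm_num
  · simp [Matrix.one_apply]
  · rw [Matrix.one_apply] at h
    split_ifs at h with h'
    · exact Or.inl h'
    · exact absurd h (lt_irrefl _)

theorem IsTransition.le_one {K : Matrix V V ℝ} (hK : IsTransition G K) (i j : V) : K i j ≤ 1 :=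
  (Finset.single_le_sum (fun i _ => hK.1 i j) (Finset.mem_univ i)).trans_eq (hK.2.1 j)

theorem IsTransition.eq_zero {K : Matrix V V ℝ} (hK : IsTransition G K) {i j : V}
    (h : ¬(i = j ∨ G.Adj i j)) : K i j = 0 :=
  le_antisymm (not_lt.1 fun h' => h (hK.2.2 i j h')) (hK.1 i j)

theorem IsTransition.isAllocation {K : Matrix V V ℝ} (hK : IsTransition G K) {M : ℝ} {z : V → ℝ}
    (hz : IsAllocation M z) : IsAllocation M (K.mulVec z) := by
  refine ⟨fun v => Finset.sum_nonneg fun j _ => mul_nonneg (hK.1 v j) (hz.1 j), ?_⟩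
  simp only [Matrix.mulVec, dotProduct]
  rw [Finset.sum_comm, ← hz.2]
  refine Finset.sum_congr rfl fun j _ => ?_
  rw [← Finset.sum_mul, hK.2.1 j, one_mul]

end Transition

/-! ### Defending with tokens -/

section Tokens

variable {V : Type u} [Fintype V] {M : ℕ}

/-- The defender distribution that answers the adversary distribution `y`: every bit of adversary
assets at `u` is mirrored, in equal amount, on the position `pos j u` of each token `j`, and the
surplus `E` is parked at `S`. -/
noncomputable def tokenResponse (pos : Fin M → V → V) (S : V) (E : ℝ) (y : V → ℝ) (v : V) : ℝ :=
  open Classical in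
  (∑ u, ∑ j, if pos j u = v then y u else 0) + if S = v then E else 0

theorem tokenResponse_isAllocation (pos : Fin M → V → V) (S : V) {E Y : ℝ} (hE : 0 ≤ E)
    {y : V → ℝ} (hy : IsAllocation Y y) :
    IsAllocation (M * Y + E) (tokenResponse pos S E y) := by
  classical
  refine ⟨fun v => add_nonneg (Finset.sum_nonneg fun u _ => Finset.sum_nonneg fun j _ => ?_) ?_,
    ?_⟩
  · split_ifs
    exacts [hy.1 u, le_rfl]
  · split_ifs
    exacts [hE, le_rfl]
  · simp only [tokenResponse]
    rw [Finset.sum_add_distrib, Finset.sum_comm]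
    congr 1
    · rw [← hy.2, Finset.mul_sum]
      refine Finset.sum_congr rfl fun u _ => ?_
      rw [Finset.sum_comm]
      simp
    · simp

/-- The response to `y` guards every vertex on which the adversary can concentrate assets with
its next move, provided some token always does. -/
theorem le_tokenResponse {G : SimpleGraph V} {pos : Fin M → V → V} (S : V) {E Y : ℝ} (hE : 0 ≤ E)
    {y : V → ℝ} (hy : IsAllocation Y y) {v : V}
    (hcover : ∀ u, u = v ∨ G.Adj u v → ∃ j, pos j u = v)
    {K : Matrix V V ℝ} (hK : IsTransition G K) :
    K.mulVec y v ≤ tokenResponse pos S E y v := by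
  classical
  refine le_add_of_le_of_nonneg (Finset.sum_le_sum fun u _ => ?_) ?_
  · have h0 : ∀ j ∈ Finset.univ, (0 : ℝ) ≤ if pos j u = v then y u else 0 := fun j _ => by
      split_ifs
      exacts [hy.1 u, le_rfl]
    by_cases h : u = v ∨ G.Adj u v
    · obtain ⟨j, hj⟩ := hcover u h
      calc K v u * y u ≤ y u := mul_le_of_le_one_left (hy.1 u) (hK.le_one v u)
        _ = if pos j u = v then y u else 0 := by rw [if_pos hj]
        _ ≤ _ := Finset.single_le_sum h0 (Finset.mem_univ j)
    · have hvu : K v u = 0 := hK.eq_zero fun h' => h (h'.imp Eq.symm fun e => e.symm)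
      simp only [hvu, zero_mul]
      exact Finset.sum_nonneg h0
  · split_ifs
    exacts [hE, le_rfl]

/-- After an adversary move, the defender can move from the response to the old distribution to
the response to the new one, because each token moves at most one step. -/
theorem exists_isTransition_tokenResponse {G : SimpleGraph V} {pos : Fin M → V → V} (S : V)
    {E Y : ℝ} (hE : 0 ≤ E) {y : V → ℝ} (hy : IsAllocation Y y)
    (hstep : ∀ j u u', G.Adj u u' → pos j u = pos j u' ∨ G.Adj (pos j u) (pos j u'))
    {K : Matrix V V ℝ} (hK : IsTransition G K) :
    ∃ K' : Matrix V V ℝ, IsTransition G K' ∧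
      K'.mulVec (tokenResponse pos S E y) = tokenResponse pos S E (K.mulVec y) := by
  classical
  have hnn : ∀ i j, (0 : ℝ) ≤
      ∑ u, ∑ t, ∑ u', if pos t u = j ∧ pos t u' = i then K u' u * y u else 0 := fun i j =>
    Finset.sum_nonneg fun u _ => Finset.sum_nonneg fun t _ => Finset.sum_nonneg fun u' _ => by
      split_ifs
      exacts [mul_nonneg (hK.1 _ _) (hy.1 _), le_rfl]
  have hnnE : ∀ i j, (0 : ℝ) ≤ if S = j ∧ S = i then E else 0 := fun i j => by
    split_ifs
    exacts [hE, le_rfl]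
  -- The assets that follow the adversary from `u` to `u'` move from `pos t u` to `pos t u'`.
  let F : V → V → ℝ := fun i j =>
    (∑ u, ∑ t, ∑ u', if pos t u = j ∧ pos t u' = i then K u' u * y u else 0) +
      if S = j ∧ S = i then E else 0
  obtain ⟨K', hK', h⟩ := exists_isTransition_of_flow (G := G) F
    (fun i j => add_nonneg (hnn i j) (hnnE i j))
    (fun i j hpos => by
      by_contra hcon
      refine hpos.ne' ((add_eq_zero_iff_of_nonneg (hnn i j) (hnnE i j)).2
        ⟨Finset.sum_eq_zero fun u _ => Finset.sum_eq_zero fun t _ =>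
          Finset.sum_eq_zero fun u' _ => ?_, ?_⟩)
      · split_ifs with h
        · obtain ⟨rfl, rfl⟩ := h
          rw [hK.eq_zero, zero_mul]
          rintro (rfl | h)
          · exact hcon (Or.inl rfl)
          · exact hcon (hstep t _ _ h)
        · rfl
      · rw [if_neg]
        rintro ⟨rfl, rfl⟩
        exact hcon (Or.inl rfl))
  refine ⟨K', hK', ?_⟩
  convert h using 1
  · congr 1
    funext j
    simp only [F, tokenResponse]
    rw [Finset.sum_add_distrib]
    congr 1
    · refine Eq.trans (Finset.sum_congr rfl fun u _ => ?_) Finset.sum_comm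
      refine Eq.trans (Finset.sum_congr rfl fun t _ => ?_) Finset.sum_comm
      refine Eq.trans ?_ Finset.sum_comm
      by_cases hj : pos t u = j
      · simp [hj, ← Finset.sum_mul, hK.2.1 u]
      · simp [hj]
    · by_cases hj : S = j <;> simp [hj]
  · funext i
    simp only [F, tokenResponse]
    rw [Finset.sum_add_distrib]
    congr 1
    · calc ∑ u', ∑ t, (if pos t u' = i then K.mulVec y u' else 0)
          = ∑ t, ∑ u', ∑ u, if pos t u' = i then K u' u * y u else 0 := by
            rw [Finset.sum_comm]
            refine Finset.sum_congr rfl fun t _ => Finset.sum_congr rfl fun u' _ => ?_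
            split_ifs
            · rfl
            · exact Finset.sum_const_zero.symm
        _ = ∑ t, ∑ u, ∑ u', if pos t u' = i then K u' u * y u else 0 :=
            Finset.sum_congr rfl fun t _ => Finset.sum_comm
        _ = ∑ u, ∑ t, ∑ u', if pos t u' = i then K u' u * y u else 0 := Finset.sum_comm
        _ = ∑ u, ∑ j, ∑ t, ∑ u', if pos t u = j ∧ pos t u' = i then K u' u * y u else 0 := by
            refine Finset.sum_congr rfl fun u _ => ?_
            refine Eq.trans (Finset.sum_congr rfl fun t _ => ?_) Finset.sum_comm
            refine Eq.trans (Finset.sum_congr rfl fun u' _ => ?_) Finset.sum_comm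
            simp only [ite_and]
            simp
        _ = _ := Finset.sum_comm
    · by_cases hi : S = i <;> simp [hi]

/-- The response depends only on the visible part of the adversary distribution, provided the
tokens do not distinguish between invisible vertices. -/
theorem tokenResponse_congr {pos : Fin M → V → V} (S : V) (E : ℝ) {Y : ℝ} {y y' : V → ℝ}
    (hy : IsAllocation Y y) (hy' : IsAllocation Y y') {A : Set V}
    (hA : ∀ j, ∀ u ∉ A, ∀ u' ∉ A, pos j u = pos j u') (h : ∀ u ∈ A, y u = y' u) :
    tokenResponse pos S E y = tokenResponse pos S E y' := by
  classical
  funext v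
  simp only [tokenResponse]
  congr 1
  rw [Finset.sum_comm, Finset.sum_comm (f := fun u j => if pos j u = v then y' u else 0)]
  refine Finset.sum_congr rfl fun j _ => ?_
  rw [← sub_eq_zero, ← Finset.sum_sub_distrib]
  -- The difference `y - y'` is supported off `A` and has total mass zero.
  have hsum : ∑ u, (y u - y' u) = 0 := by
    rw [Finset.sum_sub_distrib, hy.2, hy'.2, sub_self]
  by_cases hex : ∃ u₀, u₀ ∉ A
  · obtain ⟨u₀, hu₀⟩ := hex
    calc ∑ u, ((if pos j u = v then y u else 0) - if pos j u = v then y' u else 0)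
        = ∑ u, if pos j u₀ = v then y u - y' u else 0 := by
          refine Finset.sum_congr rfl fun u _ => ?_
          by_cases hu : u ∈ A
          · simp [h u hu]
          · rw [hA j u hu u₀ hu₀]
            split_ifs <;> simp
      _ = 0 := by split_ifs <;> simp [hsum]
  · push Not at hex
    exact Finset.sum_eq_zero fun u _ => by simp [h u (hex u)]

/-- A system of `M` tokens, whose positions depend on the position of a single visible adversary,
move at most one step when the adversary does, and together occupy all path vertices that the
adversary can reach in at most one step, yields a defense with `M` times the adversary's assets. -/
theorem canDefend_of_tokens {G : SimpleGraph V} {S T : V} {P : G.Walk S T} {k : ℕ} {X Y : ℝ}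
    (hX : M * Y ≤ X) (pos : Fin M → V → V)
    (hstep : ∀ j u u', G.Adj u u' → pos j u = pos j u' ∨ G.Adj (pos j u) (pos j u'))
    (hcover : ∀ v ∈ P.support, ∀ u, u = v ∨ G.Adj u v → ∃ j, pos j u = v)
    (hinv : ∀ j, ∀ u ∉ visibleRegion G P k, ∀ u' ∉ visibleRegion G P k, pos j u = pos j u') :
    CanDefend G P k X Y := by
  classical
  have hE : 0 ≤ X - M * Y := sub_nonneg.2 hX
  let R := tokenResponse pos S (X - M * Y)
  -- From its own distribution and the visible part of the adversary's, the defender picks a matrix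
  -- leading to the response, which does not depend on the invisible part.
  let good : (V → ℝ) → (visibleRegion G P k → ℝ) → Matrix V V ℝ → Prop := fun x yv K =>
    IsTransition G K ∧ ∃ y, IsAllocation Y y ∧ (fun v : visibleRegion G P k => y v.1) = yv ∧
      K.mulVec x = R y
  let π : Policy G P k := fun x yv => if h : ∃ K, good x yv K then h.choose else 1
  have hπ : ∀ x yv, IsTransition G (π x yv) := fun x yv => by
    simp only [π]
    split_ifs with h
    exacts [h.choose_spec.1, isTransition_one]
  have hmove : ∀ x y, IsAllocation Y y → (∃ K, IsTransition G K ∧ K.mulVec x = R y) →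
      (π x fun v => y v.1).mulVec x = R y := fun x y hy ⟨K, hK, hKx⟩ => by
    have h : ∃ K, good x (fun v => y v.1) K := ⟨K, hK, y, hy, rfl, hKx⟩
    obtain ⟨-, y', hy', hyy', hKx'⟩ := h.choose_spec
    simp only [π, dif_pos h]
    rw [hKx']
    exact tokenResponse_congr S _ hy' hy hinv fun u hu => congrFun hyy' ⟨u, hu⟩
  refine ⟨π, hπ, fun y₀ hy₀ => ⟨R y₀, ?_, ?_, fun KA hKA => ?_⟩⟩
  · have := tokenResponse_isAllocation pos S hE hy₀
    rwa [add_sub_cancel] at this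
  · intro v hv
    have := le_tokenResponse S hE hy₀ (hcover v hv) (isTransition_one (G := G))
    rwa [Matrix.one_mulVec] at this
  · have hall : ∀ t, IsAllocation Y (play π KA (R y₀) y₀ t).2 := fun t => by
      induction t with
      | zero => exact hy₀
      | succ t ih => exact (hKA t).isAllocation ih
    -- The defender's position is the response to the previous adversary distribution.
    have hresp : ∀ t, (play π KA (R y₀) y₀ (t + 1)).1 = R (play π KA (R y₀) y₀ t).2 := fun t => by
      induction t with
      | zero => exact hmove _ _ hy₀ ⟨1, isTransition_one, Matrix.one_mulVec _⟩
      | succ t ih =>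
        refine hmove _ _ (hall (t + 1)) ?_
        rw [ih]
        exact exists_isTransition_tokenResponse S hE (hall t) hstep (hKA t)
    intro t v hv
    cases t with
    | zero =>
      have := le_tokenResponse S hE hy₀ (hcover v hv) (isTransition_one (G := G))
      rwa [Matrix.one_mulVec] at this
    | succ t =>
      rw [hresp t]
      exact le_tokenResponse S hE (hall t) (hcover v hv) (hKA t)

end Tokens

/-! ### Token positions along the path -/

/-- The number of tokens that defend a path with `n` vertices when the sensing distance is `k`:
three for each full block of `2 * k + 3` path vertices and at most three for the rest. -/
def tokenCount (n k : ℕ) : ℕ := 3 * (n / (2 * k + 3)) + min (n % (2 * k + 3)) 3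

/-- The position along the path (as an index below `n`) of token `j`. Tokens come in triples, the
`b`-th one responsible for the `2 * k + 3` path vertices from `b * (2 * k + 3)` on; the triple
occupies consecutive vertices, rests in the middle of its block, and is allowed to deviate by at
most `m` from there in order to follow an adversary whose distance from the start of the path
is `s`. The outer clamping keeps an incomplete last triple at the start of its block and any
other one within the path. -/
def tokenIndex (n k m s j : ℕ) : ℕ :=
  max (j / 3 * (2 * k + 3)) (min (n - 3)
    (max (j / 3 * (2 * k + 3) + k - m) (min (j / 3 * (2 * k + 3) + k + m) (s - 1)))) + j % 3

theorem lt_tokenCount_iff {n k j : ℕ} :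
    j < tokenCount n k ↔ j / 3 * (2 * k + 3) + j % 3 < n := by
  have hn := Nat.div_add_mod' n (2 * k + 3)
  have hr := Nat.mod_lt n (show 0 < 2 * k + 3 by lia)
  unfold tokenCount
  generalize n / (2 * k + 3) = q at *
  generalize n % (2 * k + 3) = r at *
  have hj := Nat.div_add_mod j 3
  have hj' := Nat.mod_lt j (show 0 < 3 by lia)
  generalize j / 3 = b at *
  generalize j % 3 = t at *
  rcases lt_trichotomy b q with h | rfl | h
  · have := Nat.mul_le_mul_right (2 * k + 3) (Nat.succ_le_of_lt h)
    rw [Nat.succ_mul] at this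
    lia
  · lia
  · have := Nat.mul_le_mul_right (2 * k + 3) (Nat.succ_le_of_lt h)
    rw [Nat.succ_mul] at this
    lia

theorem tokenIndex_lt {n k m s j : ℕ} (hn : 3 ≤ n) (hj : j < tokenCount n k) :
    tokenIndex n k m s j < n := by
  have h := lt_tokenCount_iff.1 hj
  unfold tokenIndex
  generalize j / 3 * (2 * k + 3) = a at *
  lia

theorem tokenIndex_le_add_one {n k m s m' s' : ℕ} (j : ℕ) (hm : m ≤ m' + 1) (hm' : m' ≤ m + 1)
    (hs : s ≤ s' + 1) : tokenIndex n k m s j ≤ tokenIndex n k m' s' j + 1 := by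
  unfold tokenIndex
  generalize j / 3 * (2 * k + 3) = a at *
  omega

theorem tokenIndex_zero_left (n k s s' j : ℕ) :
    tokenIndex n k 0 s j = tokenIndex n k 0 s' j := by
  unfold tokenIndex
  lia

/-- Once the triples are free to roam their blocks, the tokens guard every path vertex at distance
at most one from the adversary. -/
theorem exists_tokenIndex_eq {n k s i : ℕ} (hi : i < n) (hs : s ≤ i + 1) (hs' : i ≤ s + 1) :
    ∃ j < tokenCount n k, tokenIndex n k k s j = i := by
  have hdm := Nat.div_add_mod' i (2 * k + 3)
  have hr := Nat.mod_lt i (show 0 < 2 * k + 3 by lia)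
  set b := i / (2 * k + 3) with hb
  obtain ⟨t, ht, h⟩ : ∃ t < 3, b * (2 * k + 3) + t < n ∧
      max (b * (2 * k + 3)) (min (n - 3) (max (b * (2 * k + 3) + k - k)
        (min (b * (2 * k + 3) + k + k) (s - 1)))) + t = i := by
    generalize b * (2 * k + 3) = a at *
    refine ⟨i - max a (min (n - 3) (max (a + k - k) (min (a + k + k) (s - 1)))), ?_, ?_, ?_⟩ <;> lia
  have h1 : (3 * b + t) / 3 = b := by lia
  have h2 : (3 * b + t) % 3 = t := by lia
  refine ⟨3 * b + t, lt_tokenCount_iff.2 ?_, ?_⟩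
  · rw [h1, h2]; exact h.1
  · unfold tokenIndex
    rw [h1, h2]; exact h.2

/-! ### Distances to the path -/

section Distance

variable {V : Type u} {G : SimpleGraph V} {S T : V}

theorem dist_le_dist_add_one {u v : V} (w : V) (h : G.Adj u v) :
    G.dist w v ≤ G.dist w u + 1 := by
  rcases h.diff_dist_adj (u := w) with h | h | h <;> lia

theorem exists_pathDist_eq (P : G.Walk S T) (u : V) :
    ∃ p ∈ P.support, pathDist G P u = G.edist u p := by
  have : Nonempty {p // p ∈ P.support} := ⟨⟨S, P.start_mem_support⟩⟩
  obtain ⟨⟨p, hp⟩, h⟩ := ciInf_mem fun p : {p // p ∈ P.support} => G.edist u p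
  exact ⟨p, hp, by rw [pathDist, iInf_subtype', ← h]⟩

theorem pathDist_le_edist {P : G.Walk S T} {p : V} (hp : p ∈ P.support) (u : V) :
    pathDist G P u ≤ G.edist u p :=
  iInf₂_le p hp

theorem pathDist_le_add_one (P : G.Walk S T) {u v : V} (h : G.Adj u v) :
    pathDist G P u ≤ pathDist G P v + 1 := by
  obtain ⟨p, hp, hv⟩ := exists_pathDist_eq P v
  calc pathDist G P u ≤ G.edist u p := pathDist_le_edist hp u
    _ ≤ G.edist u v + G.edist v p := SimpleGraph.edist_triangle
    _ = pathDist G P v + 1 := by rw [hv, SimpleGraph.edist_eq_one_iff_adj.2 h, add_comm]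

/-- How far a token triple may be displaced from its rest position when the adversary is at `u`:
one step for each step by which the adversary has approached the path within the visible region,
but not more than `k`. -/
noncomputable def slack (P : G.Walk S T) (k : ℕ) (u : V) : ℕ :=
  min k (k + 1 - (min (pathDist G P u) ((k + 1 : ℕ) : ℕ∞)).toNat)

theorem slack_of_eq_top {P : G.Walk S T} (k : ℕ) {u : V} (h : pathDist G P u = ⊤) :
    slack P k u = 0 := by
  rw [slack, h, min_eq_right le_top, ENat.toNat_natCast, Nat.sub_self, Nat.min_zero]

theorem slack_of_eq_coe {P : G.Walk S T} (k : ℕ) {u : V} {d : ℕ} (h : pathDist G P u = d) :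
    slack P k u = min k (k + 1 - d) := by
  rw [slack, h, ← Nat.mono_cast.map_min, ENat.toNat_natCast]
  lia

theorem pathDist_eq_top_or_coe (P : G.Walk S T) (u : V) :
    pathDist G P u = ⊤ ∨ ∃ d : ℕ, pathDist G P u = d := by
  induction pathDist G P u using ENat.recTopCoe <;> simp

theorem slack_le_add_one (P : G.Walk S T) (k : ℕ) {u v : V} (h : G.Adj u v) :
    slack P k u ≤ slack P k v + 1 := by
  have := pathDist_le_add_one P h.symm
  obtain hu | ⟨d, hu⟩ := pathDist_eq_top_or_coe P u
  · rw [slack_of_eq_top k hu]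
    exact Nat.zero_le _
  · rw [hu] at this
    obtain hv | ⟨d', hv⟩ := pathDist_eq_top_or_coe P v
    · rw [hv, ← Nat.cast_one, ← Nat.cast_add, top_le_iff] at this
      exact absurd this (ENat.natCast_ne_top _)
    · rw [slack_of_eq_coe k hu, slack_of_eq_coe k hv]
      rw [hv] at this
      norm_cast at this
      lia

theorem slack_eq_zero {P : G.Walk S T} {k : ℕ} {u : V} (h : u ∉ visibleRegion G P k) :
    slack P k u = 0 := by
  have h : (k : ℕ∞) < pathDist G P u := not_le.1 h
  obtain hu | ⟨d, hu⟩ := pathDist_eq_top_or_coe P u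
  · exact slack_of_eq_top k hu
  · rw [slack_of_eq_coe k hu]
    rw [hu] at h
    norm_cast at h
    lia

theorem slack_eq {P : G.Walk S T} (k : ℕ) {u p : V} (hp : p ∈ P.support) (h : u = p ∨ G.Adj u p) :
    slack P k u = k := by
  have h1 : pathDist G P u ≤ 1 := (pathDist_le_edist hp u).trans
    (SimpleGraph.edist_le_one_iff_adj_or_eq.2 h.symm)
  obtain hu | ⟨d, hu⟩ := pathDist_eq_top_or_coe P u
  · rw [hu, top_le_iff] at h1
    exact absurd h1 ENat.one_ne_top
  · rw [slack_of_eq_coe k hu]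
    rw [hu] at h1
    norm_cast at h1
    lia

theorem IsShortestPath.dist_getVert {P : G.Walk S T} (hP : IsShortestPath G P) {i : ℕ}
    (hi : i ≤ P.length) : G.dist S (P.getVert i) = i := by
  have h1 := SimpleGraph.dist_le (P.take i)
  have h2 := SimpleGraph.dist_le (P.drop i)
  have h3 := (P.take i).reachable.dist_triangle_left T
  have h4 := hP.2
  rw [SimpleGraph.Walk.take_length] at h1
  rw [SimpleGraph.Walk.drop_length] at h2
  lia

/-- Sufficiency: one token for each multiple of `Y` is enough on every shortest path. -/
theorem canDefend_of_le [Fintype V] {P : G.Walk S T} (hP : IsShortestPath G P) {n : ℕ}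
    (hn : 3 ≤ n) (hPn : P.support.length = n) {k : ℕ} {X Y : ℝ} (hX : tokenCount n k * Y ≤ X) :
    CanDefend G P k X Y := by
  rw [SimpleGraph.Walk.length_support] at hPn
  refine canDefend_of_tokens hX
    (fun j u => P.getVert (tokenIndex n k (slack P k u) (G.dist S u) j)) ?_ ?_ ?_
  · intro j u u' h
    have h1 := tokenIndex_le_add_one (n := n) (k := k) j (slack_le_add_one P k h)
      (slack_le_add_one P k h.symm) (dist_le_dist_add_one S h.symm)
    have h2 := tokenIndex_le_add_one (n := n) (k := k) j (slack_le_add_one P k h.symm)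
      (slack_le_add_one P k h) (dist_le_dist_add_one S h)
    have h3 := tokenIndex_lt (m := slack P k u) (s := G.dist S u) hn j.2
    have h4 := tokenIndex_lt (m := slack P k u') (s := G.dist S u') hn j.2
    generalize tokenIndex n k (slack P k u) (G.dist S u) j = x at *
    generalize tokenIndex n k (slack P k u') (G.dist S u') j = x' at *
    obtain rfl | rfl | rfl : x = x' ∨ x' = x + 1 ∨ x = x' + 1 := by lia
    · exact Or.inl rfl
    · exact Or.inr (P.adj_getVert_succ (by lia))
    · exact Or.inr (P.adj_getVert_succ (by lia)).symm
  · intro v hv u hu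
    rw [slack_eq k hv hu]
    obtain ⟨i, rfl, hi⟩ := SimpleGraph.Walk.mem_support_iff_exists_getVert.1 hv
    have hd := hP.dist_getVert hi
    have hs : G.dist S u ≤ i + 1 ∧ i ≤ G.dist S u + 1 := by
      rcases hu with rfl | hu
      · lia
      · have h1 := dist_le_dist_add_one S hu
        have h2 := dist_le_dist_add_one S hu.symm
        lia
    obtain ⟨j, hj, h⟩ := exists_tokenIndex_eq (n := n) (k := k) (by lia) hs.1 hs.2
    exact ⟨⟨j, hj⟩, by rw [h]⟩
  · intro j u hu u' hu'
    rw [slack_eq_zero hu, slack_eq_zero hu', tokenIndex_zero_left]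

end Distance

/-! ### Mass transport and observations -/

section Transport

variable {V : Type u} {G : SimpleGraph V}

theorem le_add_length_of_lipschitz {f : V → ℕ} (hf : ∀ u v, G.Adj u v → f u ≤ f v + 1) {u v : V}
    (p : G.Walk u v) : f u ≤ f v + p.length := by
  induction p with
  | nil => simp
  | cons h p ih =>
    have := hf _ _ h
    rw [SimpleGraph.Walk.length_cons]
    lia

variable [Fintype V]

/-- Mass found in `A` after one move was within one step of `A` before. -/
theorem IsTransition.sum_mulVec_le {K : Matrix V V ℝ} (hK : IsTransition G K) {z : V → ℝ}
    (hz : ∀ v, 0 ≤ z v) {A B : Finset V} (hAB : ∀ v ∈ A, ∀ u, v = u ∨ G.Adj v u → u ∈ B) :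
    ∑ v ∈ A, K.mulVec z v ≤ ∑ v ∈ B, z v := by
  classical
  simp only [Matrix.mulVec, dotProduct]
  rw [Finset.sum_comm, ← Finset.sum_subset (Finset.subset_univ B)]
  · refine Finset.sum_le_sum fun u _ => ?_
    rw [← Finset.sum_mul]
    refine mul_le_of_le_one_left (hz u) ?_
    rw [← hK.2.1 u]
    exact Finset.sum_le_sum_of_subset_of_nonneg (Finset.subset_univ A) fun i _ _ => hK.1 i u
  · intro u _ hu
    refine Finset.sum_eq_zero fun v hv => ?_
    rw [hK.eq_zero fun h => hu (hAB v hv u h), zero_mul]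

variable {S T : V} {P : G.Walk S T} {k : ℕ} {π : Policy G P k}

theorem play_fst_isAllocation (hπ : ∀ x y, IsTransition G (π x y)) {X : ℝ} {x₀ y₀ : V → ℝ}
    (hx₀ : IsAllocation X x₀) (KA : ℕ → Matrix V V ℝ) (t : ℕ) :
    IsAllocation X (play π KA x₀ y₀ t).1 := by
  induction t with
  | zero => exact hx₀
  | succ t ih => exact (hπ _ _).isAllocation ih

/-- Adversaries that look the same before time `t` face the same defender at time `t`. -/
theorem play_fst_congr {KA KA' : ℕ → Matrix V V ℝ} {x₀ y₀ : V → ℝ} {t : ℕ}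
    (h : ∀ s < t, ∀ v ∈ visibleRegion G P k,
      (play π KA x₀ y₀ s).2 v = (play π KA' x₀ y₀ s).2 v) :
    (play π KA x₀ y₀ t).1 = (play π KA' x₀ y₀ t).1 := by
  induction t with
  | zero => rfl
  | succ t ih =>
    have hv : (fun v : visibleRegion G P k => (play π KA x₀ y₀ t).2 v.1) =
        fun v => (play π KA' x₀ y₀ t).2 v.1 := funext fun v => h t t.lt_succ_self v.1 v.2
    simp only [play]
    rw [ih fun s hs => h s (hs.trans t.lt_succ_self), hv]

open Classical in
/-- The matrix that sends everything at `u` to `v` and leaves the rest in place. -/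
noncomputable def moveMatrix (u v : V) : Matrix V V ℝ :=
  fun i j => if i = (if j = u then v else j) then 1 else 0

theorem isTransition_moveMatrix {u v : V} (h : u = v ∨ G.Adj u v) :
    IsTransition G (moveMatrix u v) := by
  classical
  refine ⟨fun i j => ?_, fun j => ?_, fun i j hpos => ?_⟩
  · unfold moveMatrix
    split_ifs <;> norm_num
  · simp [moveMatrix]
  · by_cases hi : i = if j = u then v else j
    · split_ifs at hi with hj
      · rw [hi, hj]
        exact h.imp Eq.symm fun e => e.symm
      · exact Or.inl hi
    · simp [moveMatrix, hi] at hpos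

theorem moveMatrix_mulVec_single [DecidableEq V] (u v : V) (Y : ℝ) :
    (moveMatrix u v).mulVec (Pi.single u Y) = Pi.single v Y := by
  funext i
  rw [Matrix.mulVec_single]
  simp [moveMatrix, Pi.single_apply]

/-- An adversary that keeps all assets together and follows the itinerary `pos`. -/
theorem play_snd_moveMatrix [DecidableEq V] (pos : ℕ → V) (x₀ : V → ℝ) (Y : ℝ) (t : ℕ) :
    (play π (fun t => moveMatrix (pos t) (pos (t + 1))) x₀ (Pi.single (pos 0) Y) t).2 =
      Pi.single (pos t) Y := by
  induction t with
  | zero => rfl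
  | succ t ih =>
    simp only [play]
    rw [ih, moveMatrix_mulVec_single]

end Transport

/-! ### The strip of king's moves -/

/-- The vertices of a strip with `n` columns and `k + 2` rows. -/
abbrev Strip (n k : ℕ) : Type u := ULift.{u} (Fin n × Fin (k + 2))

/-- The column of a vertex of the strip. -/
def Strip.col {n k : ℕ} (v : Strip.{u} n k) : ℕ := v.down.1

/-- The row of a vertex of the strip. -/
def Strip.row {n k : ℕ} (v : Strip.{u} n k) : ℕ := v.down.2

theorem Strip.ext_col_row {n k : ℕ} {u v : Strip.{u} n k} (h : u.col = v.col)
    (h' : u.row = v.row) : u = v :=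
  ULift.ext _ _ (Prod.ext (Fin.ext h) (Fin.ext h'))

/-- The graph on the strip in which vertices are adjacent if they are a king's move apart. Its
row `0` is the path to be defended, and row `k + 1` is just out of the defender's sight. -/
def kingGraph (n k : ℕ) : SimpleGraph (Strip.{u} n k) where
  Adj u v := u ≠ v ∧ (u.col ≤ v.col + 1 ∧ v.col ≤ u.col + 1) ∧
    u.row ≤ v.row + 1 ∧ v.row ≤ u.row + 1
  symm := ⟨fun _ _ h => ⟨h.1.symm, h.2.1.symm, h.2.2.symm⟩⟩
  loopless := ⟨fun _ h => h.1 rfl⟩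

section King

variable {n k : ℕ}

/-- The vertex in column `i` and row `d`; indices out of range are replaced by the largest
possible one. -/
def Strip.vertex (k : ℕ) (hn : 0 < n) (i d : ℕ) : Strip.{u} n k :=
  ⟨⟨min i (n - 1), by lia⟩, ⟨min d (k + 1), by lia⟩⟩

@[simp]
theorem Strip.col_vertex (hn : 0 < n) (i d : ℕ) : (Strip.vertex.{u} k hn i d).col = min i (n - 1) :=
  rfl

@[simp]
theorem Strip.row_vertex (hn : 0 < n) (i d : ℕ) : (Strip.vertex.{u} k hn i d).row = min d (k + 1) :=
  rfl

theorem kingGraph_eq_or_adj {u v : Strip.{u} n k} (h1 : u.col ≤ v.col + 1)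
    (h2 : v.col ≤ u.col + 1) (h3 : u.row ≤ v.row + 1) (h4 : v.row ≤ u.row + 1) :
    u = v ∨ (kingGraph n k).Adj u v := by
  by_cases h : u = v
  · exact Or.inl h
  · exact Or.inr ⟨h, ⟨h1, h2⟩, h3, h4⟩

theorem exists_bottom_walk (hn : 0 < n) {m : ℕ} (hm : m < n) :
    ∃ P : (kingGraph.{u} n k).Walk (Strip.vertex k hn 0 0) (Strip.vertex k hn m 0), P.length = m ∧
      ∀ v, v ∈ P.support ↔ v.col ≤ m ∧ v.row = 0 := by
  induction m with
  | zero =>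
    refine ⟨.nil, rfl, fun v => ?_⟩
    rw [SimpleGraph.Walk.support_nil, List.mem_singleton]
    constructor
    · rintro rfl
      simp
    · rintro ⟨h1, h2⟩
      exact Strip.ext_col_row (by simp; lia) (by simp; lia)
  | succ m ih =>
    obtain ⟨P, hP, hs⟩ := ih (by lia)
    have hadj : (kingGraph.{u} n k).Adj (Strip.vertex k hn m 0) (Strip.vertex k hn (m + 1) 0) := by
      refine ⟨fun h => ?_, ⟨?_, ?_⟩, ?_, ?_⟩
      · have := congrArg Strip.col h
        simp at this
        lia
      all_goals simp
      all_goals lia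
    refine ⟨P.concat hadj, by rw [SimpleGraph.Walk.length_concat, hP], fun v => ?_⟩
    rw [SimpleGraph.Walk.support_concat, List.mem_append, hs, List.mem_singleton]
    constructor
    · rintro (h | rfl)
      · exact ⟨by lia, h.2⟩
      · simp
    · rintro ⟨h1, h2⟩
      by_cases h : v.col ≤ m
      · exact Or.inl ⟨h, h2⟩
      · exact Or.inr (Strip.ext_col_row (by simp; lia) (by simp; lia))

theorem exists_bottom_path (k : ℕ) (hn : 0 < n) :
    ∃ P : (kingGraph.{u} n k).Walk (Strip.vertex k hn 0 0) (Strip.vertex k hn (n - 1) 0),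
      IsShortestPath (kingGraph n k) P ∧ P.support.length = n ∧
        ∀ v, v ∈ P.support ↔ v.row = 0 := by
  obtain ⟨P, hP, hs⟩ := exists_bottom_walk.{u} (k := k) hn (m := n - 1) (by lia)
  have hdist : (kingGraph.{u} n k).dist (Strip.vertex k hn 0 0) (Strip.vertex k hn (n - 1) 0) =
      P.length := by
    refine le_antisymm (SimpleGraph.dist_le P) ?_
    obtain ⟨Q, hQ⟩ := P.reachable.exists_walk_length_eq_dist
    have := le_add_length_of_lipschitz (f := Strip.col)
      (fun (u v : Strip n k) (h : (kingGraph n k).Adj u v) => h.2.1.1) Q.reverse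
    rw [SimpleGraph.Walk.length_reverse, hQ] at this
    simpa [hP] using this
  refine ⟨P, ⟨P.isPath_of_length_eq_dist hdist.symm, hdist⟩, ?_, fun v => ?_⟩
  · rw [SimpleGraph.Walk.length_support]
    lia
  · rw [hs]
    refine and_iff_right ?_
    have : v.col < n := v.down.1.2
    lia

theorem notMem_visibleRegion_of_row {S T : Strip.{u} n k} {P : (kingGraph.{u} n k).Walk S T}
    (hP : ∀ v ∈ P.support, v.row = 0) {v : Strip.{u} n k} (hv : v.row = k + 1) :
    v ∉ visibleRegion (kingGraph n k) P k := by
  obtain ⟨p, hp, h⟩ := exists_pathDist_eq P v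
  have hle : ((k + 1 : ℕ) : ℕ∞) ≤ pathDist (kingGraph n k) P v := by
    rw [h]
    refine le_iInf fun w => ?_
    have := le_add_length_of_lipschitz (f := Strip.row)
      (fun (u v : Strip n k) (h : (kingGraph n k).Adj u v) => h.2.2.1) w
    rw [hP p hp, hv, zero_add] at this
    exact_mod_cast this
  exact fun hv' => absurd (hle.trans hv') (by norm_cast; lia)

/-- The vertices whose column is at most `w` away from the columns `a`, `a + 1`, `a + 2`. -/
def window (n k a w : ℕ) : Finset (Strip.{u} n k) :=
  {v | a ≤ v.col + w ∧ v.col ≤ a + 2 + w}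

theorem mem_window {a w : ℕ} {v : Strip.{u} n k} :
    v ∈ window n k a w ↔ a ≤ v.col + w ∧ v.col ≤ a + 2 + w := by
  simp [window]

theorem sum_window_le {S T : Strip.{u} n k} {P : (kingGraph.{u} n k).Walk S T}
    {π : Policy (kingGraph n k) P k} (hπ : ∀ x y, IsTransition (kingGraph n k) (π x y)) {X : ℝ}
    {x₀ y₀ : Strip.{u} n k → ℝ} (hx₀ : IsAllocation X x₀) (KA : ℕ → Matrix _ _ ℝ)
    (a w t s : ℕ) :
    ∑ v ∈ window n k a w, (play π KA x₀ y₀ (t + s)).1 v ≤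
      ∑ v ∈ window n k a (w + s), (play π KA x₀ y₀ t).1 v := by
  induction s generalizing w with
  | zero => exact le_rfl
  | succ s ih =>
    have hw : w + (s + 1) = (w + 1) + s := by lia
    rw [hw]
    refine le_trans ?_ (ih (w + 1))
    refine (hπ _ _).sum_mulVec_le (play_fst_isAllocation hπ hx₀ KA (t + s)).1 fun v hv u hu => ?_
    rw [mem_window] at hv ⊢
    rcases hu with rfl | hu
    · lia
    · have := hu.2.1
      lia

/-- The itinerary of an adversary that attacks the `j`-th target, column `b * (2 * k + 3) + j % 3`
with `b = j / 3`: along the invisible row to the middle one of the three target columns of block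
`b`, waiting there until time `n`, then down to row `1`, which is reached at time `n + k`,
and to the target. -/
def attack (n k : ℕ) (hn : 0 < n) (j t : ℕ) : Strip.{u} n k :=
  if t ≤ n + k then Strip.vertex k hn (min t (j / 3 * (2 * k + 3) + 1)) (k + 1 - (t - n))
  else Strip.vertex k hn (j / 3 * (2 * k + 3) + j % 3) 0

theorem attack_eq_or_adj (hn : 0 < n) {j : ℕ} (hj : j / 3 * (2 * k + 3) + j % 3 < n) (t : ℕ) :
    attack.{u} n k hn j t = attack n k hn j (t + 1) ∨
      (kingGraph.{u} n k).Adj (attack n k hn j t) (attack n k hn j (t + 1)) := by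
  have hj3 := Nat.mod_lt j (show 0 < 3 by lia)
  unfold attack
  generalize j / 3 * (2 * k + 3) = a at *
  generalize j % 3 = r at *
  apply kingGraph_eq_or_adj <;> split_ifs <;> simp only [Strip.col_vertex, Strip.row_vertex] <;> omega

/-- Necessity: on the strip, hidden adversaries force the defender to hold `Y` for each target, all
at the same time. -/
theorem tokenCount_mul_le_of_canDefend (hn : 0 < n) {S T : Strip.{u} n k}
    {P : (kingGraph.{u} n k).Walk S T}
    (hP : ∀ v, v ∈ P.support ↔ v.row = 0) {X Y : ℝ} (hY : 0 ≤ Y)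
    (h : CanDefend (kingGraph n k) P k X Y) : tokenCount n k * Y ≤ X := by
  classical
  obtain ⟨π, hπ, h⟩ := h
  have hy₀ : IsAllocation Y (Pi.single (Strip.vertex k hn 0 (k + 1)) Y : Strip.{u} n k → ℝ) :=
    ⟨fun v => by rw [Pi.single_apply]; split_ifs; exacts [hY, le_rfl], by simp⟩
  obtain ⟨x₀, hx₀, -, hsafe⟩ := h _ hy₀
  let KA : ℕ → ℕ → Matrix (Strip.{u} n k) (Strip.{u} n k) ℝ := fun j t =>
    moveMatrix (attack n k hn j t) (attack n k hn j (t + 1))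
  let p := fun j t => play π (KA j) x₀ (Pi.single (Strip.vertex k hn 0 (k + 1)) Y) t
  have hp2 : ∀ j t, (p j t).2 = Pi.single (attack n k hn j t) Y := fun j t => by
    have h0 : attack.{u} n k hn j 0 = Strip.vertex k hn 0 (k + 1) := by simp [attack]
    have := play_snd_moveMatrix (π := π) (attack.{u} n k hn j) x₀ Y t
    rw [h0] at this
    exact this
  have hp1 : ∀ j t, IsAllocation X (p j t).1 := fun j t => play_fst_isAllocation hπ hx₀ (KA j) t
  -- Up to time `n` nothing is visible, so the defender cannot tell any two attacks apart.
  have hblind : ∀ j j', (p j (n + 1)).1 = (p j' (n + 1)).1 := fun j j' => by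
    refine play_fst_congr fun s hs v hv => ?_
    have hinv : ∀ j, (p j s).2 v = 0 := fun j => by
      rw [hp2, Pi.single_apply, if_neg]
      rintro rfl
      refine notMem_visibleRegion_of_row (fun v hv => (hP v).1 hv) ?_ hv
      rw [attack, if_pos (by lia), Strip.row_vertex]
      lia
    exact (hinv j).trans (hinv j').symm
  -- Attacks in the same block are identical up to time `n + k`.
  have hsame : ∀ j j', j / 3 = j' / 3 → (p j (n + 1 + k)).1 = (p j' (n + 1 + k)).1 :=
    fun j j' hjj' => by
      refine play_fst_congr fun s hs v _ => ?_
      refine ((congrFun (hp2 j s) v).trans ?_).trans (congrFun (hp2 j' s) v).symm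
      simp only [attack, if_pos (show s ≤ n + k by lia), hjj']
  -- When the last attack move is made, the target must hold `Y`.
  have htarget : ∀ j < tokenCount n k,
      Y ≤ (p j (n + 1 + k)).1 (Strip.vertex k hn (j / 3 * (2 * k + 3) + j % 3) 0) := fun j hj => by
    have hj := lt_tokenCount_iff.1 hj
    have hs := hsafe (KA j) (fun t => isTransition_moveMatrix (attack_eq_or_adj hn hj t))
      (n + 1 + k) (Strip.vertex k hn (j / 3 * (2 * k + 3) + j % 3) 0) ((hP _).2 (by simp))
    refine le_trans (le_of_eq ?_) hs
    refine Eq.trans ?_ (congrFun (hp2 j (n + 1 + k)) _).symm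
    rw [attack, if_neg (by lia), Pi.single_eq_same]
  have hblock : ∀ b, ∑ j ∈ Finset.range (tokenCount n k) with j / 3 = b, Y ≤
      ∑ v ∈ window n k (b * (2 * k + 3)) k, (p 0 (n + 1)).1 v := fun b => by
    rcases Finset.eq_empty_or_nonempty
      (Finset.filter (fun j => j / 3 = b) (Finset.range (tokenCount n k))) with he | ⟨j₀, hj₀⟩
    · rw [he, Finset.sum_empty]
      exact Finset.sum_nonneg fun v _ => (hp1 _ _).1 v
    have hb : ∀ j, j ∈ Finset.filter (fun j => j / 3 = b) (Finset.range (tokenCount n k)) →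
        j < tokenCount n k ∧ j / 3 = b := fun j hj => by simpa using hj
    calc ∑ j ∈ Finset.range (tokenCount n k) with j / 3 = b, Y
        ≤ ∑ j ∈ Finset.range (tokenCount n k) with j / 3 = b,
            (p j₀ (n + 1 + k)).1 (Strip.vertex k hn (j / 3 * (2 * k + 3) + j % 3) 0) := by
          refine Finset.sum_le_sum fun j hj => ?_
          rw [hsame j₀ j ((hb _ hj₀).2.trans (hb _ hj).2.symm)]
          exact htarget j (hb j hj).1
      _ = ∑ v ∈ (Finset.filter (fun j => j / 3 = b) (Finset.range (tokenCount n k))).image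
            (fun j => Strip.vertex k hn (j / 3 * (2 * k + 3) + j % 3) 0),
            (p j₀ (n + 1 + k)).1 v := by
          refine (Finset.sum_image fun j hj j' hj' h => ?_).symm
          obtain ⟨hj, hjb⟩ := hb j hj
          obtain ⟨hj', hjb'⟩ := hb j' hj'
          have hj := lt_tokenCount_iff.1 hj
          have hj' := lt_tokenCount_iff.1 hj'
          have h := congrArg Strip.col h
          rw [Strip.col_vertex, Strip.col_vertex] at h
          rw [hjb] at h hj
          rw [hjb'] at h hj'
          have h1 := Nat.div_add_mod j 3
          have h2 := Nat.div_add_mod j' 3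
          rw [hjb] at h1
          rw [hjb'] at h2
          lia
      _ ≤ ∑ v ∈ window n k (b * (2 * k + 3)) 0, (p j₀ (n + 1 + k)).1 v := by
          refine Finset.sum_le_sum_of_subset_of_nonneg ?_ fun v _ _ => (hp1 _ _).1 v
          intro v hv
          obtain ⟨j, hj, rfl⟩ := Finset.mem_image.1 hv
          obtain ⟨hj, hjb⟩ := hb j hj
          have hj := lt_tokenCount_iff.1 hj
          rw [mem_window, Strip.col_vertex]
          rw [hjb] at hj ⊢
          lia
      _ ≤ ∑ v ∈ window n k (b * (2 * k + 3)) (0 + k), (p j₀ (n + 1)).1 v :=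
          sum_window_le hπ hx₀ (KA j₀) _ _ _ _
      _ = ∑ v ∈ window n k (b * (2 * k + 3)) k, (p 0 (n + 1)).1 v := by
          rw [zero_add, hblind j₀ 0]
  calc (tokenCount n k : ℝ) * Y = ∑ j ∈ Finset.range (tokenCount n k), Y := by simp
    _ = ∑ b ∈ Finset.range (tokenCount n k),
          ∑ j ∈ Finset.range (tokenCount n k) with j / 3 = b, Y :=
        (Finset.sum_fiberwise_of_maps_to (fun j hj => Finset.mem_range.2
          ((Nat.div_le_self j 3).trans_lt (Finset.mem_range.1 hj))) _).symm
    _ ≤ ∑ b ∈ Finset.range (tokenCount n k),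
          ∑ v ∈ window n k (b * (2 * k + 3)) k, (p 0 (n + 1)).1 v :=
        Finset.sum_le_sum fun b _ => hblock b
    _ = ∑ v ∈ (Finset.range (tokenCount n k)).biUnion fun b => window n k (b * (2 * k + 3)) k,
          (p 0 (n + 1)).1 v := by
        -- The windows have width `2 * k + 3`, the distance between consecutive blocks.
        refine (Finset.sum_biUnion fun b _ b' _ hbb' => Finset.disjoint_left.2 fun v hv hv' =>
          hbb' ?_).symm
        rw [mem_window] at hv hv'
        by_contra hne
        rcases lt_or_gt_of_ne hne with hlt | hlt
        · have := Nat.mul_le_mul_right (2 * k + 3) (Nat.succ_le_of_lt hlt)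
          rw [Nat.succ_mul] at this
          lia
        · have := Nat.mul_le_mul_right (2 * k + 3) (Nat.succ_le_of_lt hlt)
          rw [Nat.succ_mul] at this
          lia
    _ ≤ ∑ v, (p 0 (n + 1)).1 v :=
        Finset.sum_le_sum_of_subset_of_nonneg (Finset.subset_univ _) fun v _ _ => (hp1 _ _).1 v
    _ = X := (hp1 _ _).2

end King

end PathDefense

theorem theorem1 (n k : ℕ) (hn : 3 ≤ n) (X Y : ℝ) (hX : 0 < X) (hY : 0 < Y) :
    (∀ (V : Type u) [Fintype V] (G : SimpleGraph V) (S T : V) (P : G.Walk S T),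
        PathDefense.IsShortestPath G P → P.support.length = n →
          PathDefense.CanDefend G P k X Y) ↔
      X ≥ ((3 * (n / (2 * k + 3)) + min (n % (2 * k + 3)) 3 : ℕ) : ℝ) * Y := by
  constructor
  · intro h
    have hn' : 0 < n := by lia
    obtain ⟨P, hP, hlen, hs⟩ := PathDefense.exists_bottom_path.{u} k hn'
    exact PathDefense.tokenCount_mul_le_of_canDefend hn' hs hY.le (h _ _ _ _ P hP hlen)
  · intro h V _ G S T P hP hlen
    exact PathDefense.canDefend_of_le hP hn hlen h
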